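/- Let $\tau$ be a finite signature consisting of relation and constant symbols, and let $R$ be a further relation symbol. Structures are nonempty and may have any cardinality. The Gaifman graph $G_A$ of a structure $A$ joins distinct $a,b\in A$ iff both occur in a common tuple of some relation of $A$; $B_{G_A}(a,r)$ is the set of points at distance at most $r$ from $a$ in $G_A$. The structure $A$ is locally finite if every point has finite degree in $G_A$; $\mathfrak K^{<\omega}_\tau$ is the class of locally finite $\tau$-structures. The pointed $r$-neighborhood $\mathcal N_r^A(a)$ is the restriction of $A$ to $B_{G_A}(a,r)$ with distinguished point $a$ (a constant symbol is interpreted in the restriction iff its value lies in the ball). $A$ and $B$ are Hanf equivalent, $A\approx B$, if for every $r\in\omega$ and every pointed structure $C$ the sets $\{a\in A: \mathcal N_r^A(a)\cong C\}$ and $\{b\in B:\mathcal N_r^B(b)\cong C\}$ either have the same cardinality or are both infinite. A presentation scheme $\mathbb P$ for $\mathfrak K^{<\omega}_\tau$ is a collection of expansions of members of $\mathfrak K^{<\omega}_\tau$ to $\tau\cup\{R\}$-structures which contains at least one expansion of each member; write $A^*\,\mathbb P\,A$ if $A^*\in\mathbb P$ and $A^*$ is an expansion of $A$. $\mathbb P$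 is elementary if there is a first-order sentence $\theta$ of signature $\tau\cup\{R\}$ such that for all $A\in\mathfrak K^{<\omega}_\tau$ and all expansions $A^*$ of $A$ to $\tau\cup\{R\}$, $A^*\in\mathbb P$ iff $A^*\models\theta$. $\mathbb P$ is neighborhood bounded if there is a constant $\nu\in\omega$ such that $B_{G_{A^*}}(a,1)\subseteq B_{G_A}(a,\nu)$ whenever $A\in\mathfrak K^{<\omega}_\tau$, $A^*\,\mathbb P\,A$ and $a\in A$. A class $\mathfrak J$ of $\tau$-structures is $\mathbb P$-invariant elementary on $\mathfrak K^{<\omega}_\tau$ if there is a first-order sentence $\theta$ of signature $\tau\cup\{R\}$ such that for every $A\in\mathfrak K^{<\omega}_\tau$: some $A^*$ with $A^*\,\mathbb P\,A$ satisfies $\theta$ iff every $A^*$ with $A^*\,\mathbb P\,A$ satisfies $\theta$; and $A\in\mathfrak J$ iff some $A^*$ with $A^*\,\mathbb P\,A$ satisfies $\theta$. **Theorem.** Let $\mathbb P$ be an elementary, neighborhood bounded presentation scheme for $\mathfrak K^{<\omega}_\tau$ and let $\mathfrak J$ be a class of $\tau$-structures which is $\mathbb P$-invariant elementary on $\mathfrak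 K^{<\omega}_\tau$. If $A,B\in\mathfrak K^{<\omega}_\tau$ and $A\approx B$, then $A\in\mathfrak J$ if and only if $B\in\mathfrak J$. -/

import Mathlib

open scoped FirstOrder
open scoped Cardinal

universe u v w

/-- A member of the class of all `L`-structures (with nonempty universe). -/
structure Str (L : FirstOrder.Language.{u, v}) where
  carrier : Type w
  [str : L.Structure carrier]
  [nonempty : Nonempty carrier]

namespace Str

attribute [instance] Str.str Str.nonempty

variable {L : FirstOrder.Language.{u, v}}

/-- The Gaifman graph: distinct elements are adjacent iff they occur together in some tuple of
some relation of the structure. -/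
def gaifman (A : Str.{u, v, w} L) : SimpleGraph A.carrier where
  Adj a b := a ≠ b ∧ ∃ (n : ℕ) (R : L.Relations n) (c : Fin n → A.carrier),
    FirstOrder.Language.Structure.RelMap R c ∧ ∃ i j, c i = a ∧ c j = b
  symm := ⟨by
    rintro a b ⟨hab, n, R, c, hc, i, j, hi, hj⟩
    exact ⟨hab.symm, n, R, c, hc, j, i, hj, hi⟩⟩
  loopless := ⟨fun _ h => h.1 rfl⟩

/-- The set of points at distance at most `r` from `a` in the Gaifman graph (points in different
connected components have distance `⊤`). -/
def closedBall (A : Str.{u, v, w} L) (a : A.carrier) (r : ℕ) : Set A.carrier :=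
  {c | A.gaifman.edist a c ≤ (r : ℕ∞)}

theorem mem_closedBall_self (A : Str.{u, v, w} L) (a : A.carrier) (r : ℕ) :
    a ∈ A.closedBall a r := by
  simp [closedBall]

/-- Satisfaction of a first-order sentence. -/
def Sat (A : Str.{u, v, w} L) (θ : L.Sentence) : Prop :=
  A.carrier ⊨ θ

end Str

/-- The class of locally finite `L`-structures: every point has finite degree in the Gaifman
graph. -/
def locallyFinite (L : FirstOrder.Language.{u, v}) : Set (Str.{u, v, w} L) :=
  {A | ∀ a : A.carrier, (A.gaifman.neighborSet a).Finite}

/-! ### Pointed neighborhoods and Hanf equivalence -/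

/-- Pointed structures for a signature with relation and constant symbols only. A constant may be
undefined: the restriction of a structure to a set interprets exactly those constants whose value
lies in that set. -/
structure PointedStr (L : FirstOrder.Language.{u, v}) where
  carrier : Type w
  point : carrier
  rel : ∀ {n : ℕ}, L.Relations n → (Fin n → carrier) → Prop
  const : L.Constants → Part carrier

/-- Isomorphism of pointed structures. -/
def PointedStr.Iso {L : FirstOrder.Language.{u, v}} (C D : PointedStr.{u, v, w} L) : Prop :=
  ∃ e : C.carrier ≃ D.carrier,
    e C.point = D.point ∧
    (∀ (n : ℕ) (R : L.Relations n) (x : Fin n → C.carrier),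
      C.rel R x ↔ D.rel R (fun i => e (x i))) ∧
    ∀ c : L.Constants, (C.const c).map e = D.const c

/-- The pointed `r`-neighborhood of `a` in `A`: the restriction of `A` to the closed ball of
radius `r` around `a`, with `a` as its distinguished point. -/
def Str.nbhd {L : FirstOrder.Language.{u, v}} (A : Str.{u, v, w} L) (a : A.carrier) (r : ℕ) :
    PointedStr.{u, v, w} L where
  carrier := A.closedBall a r
  point := ⟨a, A.mem_closedBall_self a r⟩
  rel R x := FirstOrder.Language.Structure.RelMap R (fun i => (x i : A.carrier))
  const c := ⟨(c : A.carrier) ∈ A.closedBall a r, fun h => ⟨(c : A.carrier), h⟩⟩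

/-- Two sets are equipollent up to threshold `t`. -/
def EquipollentUpTo {α β : Type w} (t : Cardinal.{w}) (X : Set α) (Y : Set β) : Prop :=
  #X = #Y ∨ (t ≤ #X ∧ t ≤ #Y)

/-- Hanf threshold `r,t`-equivalence: each isomorphism type of pointed `r`-neighborhoods is
realized the same number of times up to threshold `t`. -/
def HanfThresholdEquiv {L : FirstOrder.Language.{u, v}} (r : ℕ) (t : Cardinal.{w})
    (A B : Str.{u, v, w} L) : Prop :=
  ∀ C : PointedStr.{u, v, w} L,
    EquipollentUpTo t {a : A.carrier | (A.nbhd a r).Iso C} {b : B.carrier | (B.nbhd b r).Iso C}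

/-- Hanf equivalence: Hanf threshold `r,ω`-equivalence for every finite radius `r`. -/
def HanfEquiv {L : FirstOrder.Language.{u, v}} (A B : Str.{u, v, w} L) : Prop :=
  ∀ r : ℕ, HanfThresholdEquiv r ℵ₀ A B

/-! ### Presentations -/

/-- The symbols of a signature with one relation symbol, of arity `k`. -/
inductive SingleRel (k : ℕ) : ℕ → Type v
  | sym : SingleRel k k

/-- The signature consisting of one relation symbol, of arity `k`. -/
def singleRelLanguage (k : ℕ) : FirstOrder.Language.{u, v} :=
  ⟨fun _ => PEmpty, SingleRel k⟩

/-- The signature `L ∪ {R}`, where `R` is a new relation symbol of arity `k`. -/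
abbrev withRel (L : FirstOrder.Language.{u, v}) (k : ℕ) : FirstOrder.Language.{u, v} :=
  L.sum (singleRelLanguage.{u, v} k)

/-- A `k`-ary relation as a structure for the signature with one `k`-ary relation symbol. -/
abbrev singleRelStructure {M : Type w} {k : ℕ} (S : (Fin k → M) → Prop) :
    (singleRelLanguage.{u, v} k).Structure M where
  funMap f := PEmpty.elim f
  RelMap := fun {_} R => match R with
    | SingleRel.sym => S

/-- The expansion of `A` to an `L ∪ {R}`-structure which interprets `R` by `S`. The
`R`-presentations of `A` are exactly the structures `A.expand S`. -/
abbrev Str.expand {L : FirstOrder.Language.{u, v}} (A : Str.{u, v, w} L) {k : ℕ}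
    (S : (Fin k → A.carrier) → Prop) : Str.{u, v, w} (withRel L k) :=
  letI := singleRelStructure.{u, v, w} S
  { carrier := A.carrier
    str := inferInstance
    nonempty := A.nonempty }

/-- `P` is a presentation scheme for the class `K`: a collection of `R`-presentations of members
of `K` that contains at least one presentation of each member of `K`. -/
def IsPresentationScheme {L : FirstOrder.Language.{u, v}} {k : ℕ}
    (P : Set (Str.{u, v, w} (withRel L k)))
    (K : Set (Str.{u, v, w} L)) : Prop :=
  (∀ D ∈ P, ∃ A ∈ K, ∃ S : (Fin k → A.carrier) → Prop, D = A.expand S) ∧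
  ∀ A ∈ K, ∃ S : (Fin k → A.carrier) → Prop, A.expand S ∈ P

/-- `P` is an elementary presentation scheme for `K`. -/
def IsElementaryScheme {L : FirstOrder.Language.{u, v}} {k : ℕ}
    (P : Set (Str.{u, v, w} (withRel L k)))
    (K : Set (Str.{u, v, w} L)) : Prop :=
  IsPresentationScheme P K ∧
  ∃ θ : (withRel L k).Sentence, ∀ A ∈ K, ∀ S : (Fin k → A.carrier) → Prop,
    A.expand S ∈ P ↔ (A.expand S).Sat θ

/-- The sentence `θ` is `P`-invariant over `K`. -/
def IsInvariantSentence {L : FirstOrder.Language.{u, v}} {k : ℕ}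
    (P : Set (Str.{u, v, w} (withRel L k)))
    (K : Set (Str.{u, v, w} L)) (θ : (withRel L k).Sentence) : Prop :=
  ∀ A ∈ K,
    (∃ S : (Fin k → A.carrier) → Prop, A.expand S ∈ P ∧ (A.expand S).Sat θ) ↔
      ∀ S : (Fin k → A.carrier) → Prop, A.expand S ∈ P → (A.expand S).Sat θ

/-- The boolean query `J` is `P`-invariant elementary on `K`. -/
def IsInvariantElementary {L : FirstOrder.Language.{u, v}} {k : ℕ}
    (P : Set (Str.{u, v, w} (withRel L k)))
    (K J : Set (Str.{u, v, w} L)) : Prop :=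
  ∃ θ : (withRel L k).Sentence, IsInvariantSentence P K θ ∧
    ∀ A ∈ K, A ∈ J ↔
      ∃ S : (Fin k → A.carrier) → Prop, A.expand S ∈ P ∧ (A.expand S).Sat θ

/-- `P` is neighborhood bounded: there is a neighborhood expansion factor `ν` such that Gaifman
neighbors in a presentation of a locally finite structure are at distance at most `ν` in the
structure itself. -/
def NeighborhoodBounded {L : FirstOrder.Language.{u, v}} {k : ℕ}
    (P : Set (Str.{u, v, w} (withRel L k))) : Prop :=
  ∃ ν : ℕ, ∀ A ∈ locallyFinite.{u, v, w} L, ∀ S : (Fin k → A.carrier) → Prop,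
    A.expand S ∈ P → ∀ a : A.carrier, (A.expand S).closedBall a 1 ⊆ A.closedBall a ν

/-! The two structures are compared through a common extension `D`, rather than by matching
presentations of `A` and `B` directly. Call a point of finite type if one of its neighborhoods
occurs only finitely often. By local finiteness such points form a union of connected components,
and it contains all constants. Hanf equivalence makes the finite-type parts of `A` and `B`
isomorphic (`exists_finType_bijOn`): the finite partial isomorphisms have a limit along an
ultrafilter, since each point of finite type has only finitely many possible images. Adjoining the
remaining components of `B` to `A` gives a locally finite `D` containing both `A` and `B` as unions
of components, and every neighborhood of a remaining point occurs infinitely often in the smaller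
structure (`exists_common_closedEmb`).

Now let `(A, S)` be a presentation. On each new component of `D`, define `U` as an ultralimit of
copies of `S`, pulled back along isomorphisms of larger and larger balls with distinct centers in
`A` (`ClosedEmb.exists_extension`). Locality of `S` makes `U` local, and every neighborhood of a new
point of `(D, U)` occurs infinitely often in `(A, S)`. Hence `(A, S)` and `(D, U)` agree on
neighborhood counts, and Hanf's theorem (`sat_iff_of_typeCountEq`) makes them elementarily
equivalent. As the scheme is elementary, `U` is again a presentation; invariance over `D` then gives
`A ∈ J ↔ D ∈ J`, and likewise for `B`. -/

open FirstOrder.Language.Structure (RelMap)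

namespace Str

variable {L : FirstOrder.Language.{u, v}} {A B D : Str.{u, v, w} L}

/-! ### Neighborhoods of sets -/

/-- `A.Near r a b`: the Gaifman distance of `a` and `b` is at most `r`. -/
def Near (A : Str.{u, v, w} L) (r : ℕ) (a b : A.carrier) : Prop :=
  A.gaifman.edist a b ≤ (r : ℕ∞)

/-- The set of points at distance at most `r` from `X`. -/
def nb (A : Str.{u, v, w} L) (r : ℕ) (X : Set A.carrier) : Set A.carrier :=
  {y | ∃ x ∈ X, A.Near r x y}

theorem Near.refl (r : ℕ) (a : A.carrier) : A.Near r a a := by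
  simp [Near]

theorem Near.symm {r : ℕ} {a b : A.carrier} (h : A.Near r a b) : A.Near r b a := by
  rwa [Near, SimpleGraph.edist_comm]

theorem Near.mono {r s : ℕ} (hrs : r ≤ s) {a b : A.carrier} (h : A.Near r a b) : A.Near s a b :=
  le_trans h (by exact_mod_cast hrs)

theorem Near.trans {r s : ℕ} {a b c : A.carrier} (h : A.Near r a b) (h' : A.Near s b c) :
    A.Near (r + s) a c := by
  refine le_trans (SimpleGraph.edist_triangle (v := b)) ?_
  push_cast
  exact add_le_add h h'

theorem near_zero_iff {a b : A.carrier} : A.Near 0 a b ↔ a = b := by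
  simp [Near]

theorem near_one_iff {a b : A.carrier} : A.Near 1 a b ↔ A.gaifman.Adj a b ∨ a = b := by
  simpa [Near] using SimpleGraph.edist_le_one_iff_adj_or_eq

theorem near_one_of_rel {n : ℕ} {R : L.Relations n} {x : Fin n → A.carrier} (h : RelMap R x)
    (i j : Fin n) : A.Near 1 (x i) (x j) := by
  rw [near_one_iff]
  by_cases hij : x i = x j
  · exact Or.inr hij
  · exact Or.inl ⟨hij, n, R, x, h, i, j, rfl, rfl⟩

theorem Near.exists_step {r : ℕ} {a b : A.carrier} (h : A.Near (r + 1) a b) :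
    ∃ c, A.Near r a c ∧ A.Near 1 c b := by
  have hne : A.gaifman.edist a b ≠ ⊤ := ne_top_of_le_ne_top (ENat.natCast_ne_top _) h
  obtain ⟨p, hp⟩ := SimpleGraph.exists_walk_of_edist_ne_top hne
  -- A walk is taken apart at its start, so it is reversed to expose the last edge.
  have hl : p.reverse.length ≤ r + 1 := by
    rw [Near, ← hp] at h
    rw [SimpleGraph.Walk.length_reverse]
    exact_mod_cast h
  generalize p.reverse = q at hl
  cases q with
  | nil => exact ⟨_, Near.refl _ _, Near.refl _ _⟩
  | cons hadj q =>
    refine ⟨_, ?_, near_one_iff.2 (Or.inl hadj.symm)⟩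
    refine Near.symm (le_trans (SimpleGraph.edist_le q) ?_)
    simp only [SimpleGraph.Walk.length_cons] at hl
    exact_mod_cast Nat.le_of_succ_le_succ hl

theorem subset_nb (r : ℕ) (X : Set A.carrier) : X ⊆ A.nb r X :=
  fun x hx => ⟨x, hx, Near.refl _ _⟩

theorem mem_nb_singleton {r : ℕ} {a b : A.carrier} : b ∈ A.nb r {a} ↔ A.Near r a b := by
  simp [nb]

theorem nb_singleton (r : ℕ) (a : A.carrier) : A.nb r {a} = A.closedBall a r := by
  ext b
  exact mem_nb_singleton

theorem nb_union (r : ℕ) (X Y : Set A.carrier) : A.nb r (X ∪ Y) = A.nb r X ∪ A.nb r Y := by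
  ext y
  simp [nb, or_and_right, exists_or]

theorem nb_of_near {r s t : ℕ} (hrs : r + s ≤ t) {X : Set A.carrier} {x y : A.carrier}
    (hx : x ∈ A.nb r X) (h : A.Near s x y) : y ∈ A.nb t X := by
  obtain ⟨a, ha, hax⟩ := hx
  exact ⟨a, ha, (hax.trans h).mono hrs⟩

theorem nb_nb_subset {r s t : ℕ} (hrs : r + s ≤ t) {X Y : Set A.carrier} (hY : Y ⊆ A.nb r X) :
    A.nb s Y ⊆ A.nb t X := by
  rintro y ⟨x, hx, h⟩
  exact nb_of_near hrs (hY hx) h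

theorem finite_nb (hA : A ∈ locallyFinite L) (r : ℕ) {X : Set A.carrier} (hX : X.Finite) :
    (A.nb r X).Finite := by
  induction r with
  | zero =>
    refine hX.subset ?_
    rintro y ⟨x, hx, h⟩
    rw [near_zero_iff] at h
    exact h ▸ hx
  | succ r ih =>
    refine (ih.union (ih.biUnion fun x _ => hA x)).subset ?_
    rintro y ⟨x, hx, h⟩
    obtain ⟨z, hz, hzy⟩ := h.exists_step
    rcases near_one_iff.1 hzy with h1 | h1
    · exact Or.inr (Set.mem_biUnion (x := z) ⟨x, hx, hz⟩ h1)
    · exact Or.inl ⟨x, hx, h1 ▸ hz⟩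

/-! ### Isomorphisms of neighborhoods -/

variable {k : ℕ} {S : (Fin k → A.carrier) → Prop} {T : (Fin k → B.carrier) → Prop}
  {U : (Fin k → D.carrier) → Prop}

/-- `f` restricts to an isomorphism of the `r`-neighborhood of `X` in `(A, S)` with the
`r`-neighborhood of the image of `X` in `(B, T)`. -/
structure BallIso (S : (Fin k → A.carrier) → Prop) (T : (Fin k → B.carrier) → Prop)
    (r : ℕ) (X : Set A.carrier) (f : A.carrier → B.carrier) : Prop where
  bij : Set.BijOn f (A.nb r X) (B.nb r (f '' X))
  rel : ∀ (n : ℕ) (R : L.Relations n) (x : Fin n → A.carrier), (∀ i, x i ∈ A.nb r X) →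
    (RelMap R x ↔ RelMap R (f ∘ x))
  ext : ∀ x : Fin k → A.carrier, (∀ i, x i ∈ A.nb r X) → (S x ↔ T (f ∘ x))
  const : ∀ (c : L.Constants) (x : A.carrier), x ∈ A.nb r X →
    (x = (c : A.carrier) ↔ f x = (c : B.carrier))

namespace BallIso

/-- A path of length `s` starting at depth `d` never leaves depth `d + s ≤ r`, so all tuples
witnessing its edges lie where `f` preserves relations. -/
theorem near {r : ℕ} {X : Set A.carrier} {f : A.carrier → B.carrier} (h : BallIso S T r X f)
    {d s : ℕ} (hds : d + s ≤ r) {x y : A.carrier} (hx : x ∈ A.nb d X) (hxy : A.Near s x y) :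
    B.Near s (f x) (f y) := by
  induction s generalizing y with
  | zero => rw [near_zero_iff] at hxy ⊢; rw [hxy]
  | succ s ih =>
    obtain ⟨z, hz, hzy⟩ := hxy.exists_step
    refine (ih (by omega) hz).trans ?_
    rcases near_one_iff.1 hzy with ⟨hne, n, R, c, hR, i, j, rfl, rfl⟩ | rfl
    · refine near_one_of_rel (R := R) (x := f ∘ c) ((h.rel n R c fun l => ?_).1 hR) i j
      -- Every entry of the witnessing tuple, not just the endpoints of the edge, is within 1 of
      -- `z`.
      exact nb_of_near (r := d) (s := s + 1) (by omega) hx (hz.trans (near_one_of_rel hR i l))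
    · exact Near.refl _ _

theorem symm {r : ℕ} {X : Set A.carrier} {f : A.carrier → B.carrier} (h : BallIso S T r X f) :
    ∃ g : B.carrier → A.carrier, BallIso T S r (f '' X) g ∧
      Set.InvOn g f (A.nb r X) (B.nb r (f '' X)) := by
  classical
  have hinv := h.bij.invOn_invFunOn
  set g := Function.invFunOn f (A.nb r X)
  have hgX : g '' (f '' X) = X := by
    rw [Set.image_image]
    ext x
    constructor
    · rintro ⟨y, hy, rfl⟩
      simpa only [hinv.1 (subset_nb _ _ hy)] using hy
    · exact fun hx => ⟨x, hx, hinv.1 (subset_nb _ _ hx)⟩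
  have hbij : Set.BijOn g (B.nb r (f '' X)) (A.nb r X) := (Set.bijOn_comm hinv).2 h.bij
  have hfg : ∀ {n : ℕ} (x : Fin n → B.carrier), (∀ i, x i ∈ B.nb r (f '' X)) →
      f ∘ (g ∘ x) = x := fun x hx => funext fun i => hinv.2 (hx i)
  refine ⟨g, ⟨by rwa [hgX], fun n R x hx => ?_, fun x hx => ?_, fun c x hx => ?_⟩, hinv⟩
  · rw [h.rel n R (g ∘ x) fun i => hbij.mapsTo (hx i), hfg x hx]
  · rw [h.ext (g ∘ x) fun i => hbij.mapsTo (hx i), hfg x hx]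
  · rw [h.const c (g x) (hbij.mapsTo hx), hinv.2 hx]

theorem image_nb {r : ℕ} {X : Set A.carrier} {f : A.carrier → B.carrier} (h : BallIso S T r X f)
    {d s : ℕ} (hds : d + s ≤ r) {Y : Set A.carrier} (hY : Y ⊆ A.nb d X) :
    f '' A.nb s Y = B.nb s (f '' Y) := by
  apply Set.Subset.antisymm
  · rintro _ ⟨y, ⟨x, hx, hxy⟩, rfl⟩
    exact ⟨f x, ⟨x, hx, rfl⟩, h.near hds (hY hx) hxy⟩
  · rintro z ⟨_, ⟨x, hx, rfl⟩, hxz⟩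
    obtain ⟨g, hg, hinv⟩ := h.symm
    obtain ⟨a, ha, hax⟩ := hY hx
    have hfx : f x ∈ B.nb d (f '' X) :=
      ⟨f a, ⟨a, ha, rfl⟩, h.near (d := 0) (by omega) (subset_nb _ _ ha) hax⟩
    have hxr : x ∈ A.nb r X := ⟨a, ha, hax.mono (by omega)⟩
    refine ⟨g z, ⟨x, hx, ?_⟩, hinv.2 (nb_of_near hds hfx hxz)⟩
    have := hg.near hds hfx hxz
    rwa [hinv.1 hxr] at this

theorem restrict {r : ℕ} {X : Set A.carrier} {f : A.carrier → B.carrier} (h : BallIso S T r X f)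
    {d s : ℕ} (hds : d + s ≤ r) {Y : Set A.carrier} (hY : Y ⊆ A.nb d X) :
    BallIso S T s Y f := by
  have hsub : A.nb s Y ⊆ A.nb r X := nb_nb_subset hds hY
  refine ⟨?_, fun n R x hx => h.rel n R x fun i => hsub (hx i),
    fun x hx => h.ext x fun i => hsub (hx i), fun c x hx => h.const c x (hsub hx)⟩
  rw [← h.image_nb hds hY]
  exact (h.bij.injOn.mono hsub).bijOn_image

theorem mono {r s : ℕ} (hsr : s ≤ r) {X Y : Set A.carrier} {f : A.carrier → B.carrier}
    (h : BallIso S T r X f) (hY : Y ⊆ X) : BallIso S T s Y f :=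
  h.restrict (d := 0) (by omega) (hY.trans (subset_nb _ _))

theorem comp {r : ℕ} {X : Set A.carrier} {f : A.carrier → B.carrier} {g : B.carrier → D.carrier}
    (hg : BallIso T U r (f '' X) g) (hf : BallIso S T r X f) : BallIso S U r X (g ∘ f) := by
  refine ⟨?_, fun n R x hx => ?_, fun x hx => ?_, fun c x hx => ?_⟩
  · rw [Set.image_comp]
    exact hg.bij.comp hf.bij
  · exact (hf.rel n R x hx).trans (hg.rel n R _ fun i => hf.bij.mapsTo (hx i))
  · exact (hf.ext x hx).trans (hg.ext _ fun i => hf.bij.mapsTo (hx i))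
  · rw [hf.const c x hx, hg.const c _ (hf.bij.mapsTo hx)]
    rfl

theorem congr {r : ℕ} {X : Set A.carrier} {f g : A.carrier → B.carrier} (h : BallIso S T r X f)
    (hfg : Set.EqOn f g (A.nb r X)) : BallIso S T r X g := by
  have hx' : ∀ {n : ℕ} (x : Fin n → A.carrier), (∀ i, x i ∈ A.nb r X) → g ∘ x = f ∘ x :=
    fun x hx => funext fun i => (hfg (hx i)).symm
  refine ⟨?_, fun n R x hx => ?_, fun x hx => ?_, fun c x hx => ?_⟩
  · rw [← (hfg.mono (subset_nb _ _)).image_eq]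
    exact h.bij.congr hfg
  · rw [h.rel n R x hx, hx' x hx]
  · rw [h.ext x hx, hx' x hx]
  · rw [h.const c x hx, hfg hx]

theorem id (r : ℕ) (X : Set A.carrier) : BallIso S S r X id :=
  ⟨by rw [Set.image_id]; exact Set.bijOn_id _, fun _ _ _ _ => Iff.rfl, fun _ _ => Iff.rfl,
    fun _ _ _ => Iff.rfl⟩

end BallIso

/-- The pointed `r`-neighborhoods of `a` in `(A, S)` and of `b` in `(B, T)` are isomorphic. -/
def PtIso (S : (Fin k → A.carrier) → Prop) (T : (Fin k → B.carrier) → Prop)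
    (r : ℕ) (a : A.carrier) (b : B.carrier) : Prop :=
  ∃ f, BallIso S T r {a} f ∧ f a = b

namespace PtIso

theorem refl (r : ℕ) (a : A.carrier) : PtIso S S r a a := ⟨id, BallIso.id _ _, rfl⟩

theorem symm {r : ℕ} {a : A.carrier} {b : B.carrier} (h : PtIso S T r a b) :
    PtIso T S r b a := by
  obtain ⟨f, hf, rfl⟩ := h
  obtain ⟨g, hg, hinv⟩ := hf.symm
  rw [Set.image_singleton] at hg
  exact ⟨g, hg, hinv.1 (subset_nb _ _ rfl)⟩

theorem trans {r : ℕ} {a : A.carrier} {b : B.carrier} {d : D.carrier} (h : PtIso S T r a b)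
    (h' : PtIso T U r b d) : PtIso S U r a d := by
  obtain ⟨f, hf, rfl⟩ := h
  obtain ⟨g, hg, rfl⟩ := h'
  exact ⟨g ∘ f, BallIso.comp (by rwa [Set.image_singleton]) hf, rfl⟩

theorem mono {r s : ℕ} (hsr : s ≤ r) {a : A.carrier} {b : B.carrier} (h : PtIso S T r a b) :
    PtIso S T s a b := by
  obtain ⟨f, hf, rfl⟩ := h
  exact ⟨f, hf.mono hsr subset_rfl, rfl⟩

end PtIso

theorem BallIso.ptIso {r : ℕ} {X : Set A.carrier} {f : A.carrier → B.carrier}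
    (h : BallIso S T r X f) {d s : ℕ} (hds : d + s ≤ r) {x : A.carrier} (hx : x ∈ A.nb d X) :
    PtIso S T s x (f x) :=
  ⟨f, h.restrict hds (by simpa using hx), rfl⟩

/-- Each isomorphism type of pointed `r`-neighborhoods realized in `(A, S)` is realized in `(A, S)`
and in `(B, T)` the same finite number of times, or infinitely often in both. -/
def TypeCountEq (S : (Fin k → A.carrier) → Prop) (T : (Fin k → B.carrier) → Prop) : Prop :=
  ∀ (r : ℕ) (a : A.carrier), {a' | PtIso S S r a a'}.encard = {b | PtIso S T r a b}.encard

/-- Tuples in `S` have diameter at most `m`. -/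
def Local (m : ℕ) (S : (Fin k → A.carrier) → Prop) : Prop :=
  ∀ x, S x → ∀ i j, A.Near m (x i) (x j)

/-! ### Extending isomorphisms of neighborhoods by one point -/

/-- A tuple meeting both sides has two entries further than `m` apart, so local relations fail for
it and for its image. -/
theorem glue_iff {m n : ℕ} {Q : (Fin n → A.carrier) → Prop} {Q' : (Fin n → B.carrier) → Prop}
    (hQ : Local m Q) (hQ' : Local m Q') {V W : Set A.carrier} {V' W' : Set B.carrier}
    {f : A.carrier → B.carrier} (hV : Set.MapsTo f V V') (hW : Set.MapsTo f W W')
    (hsep : ∀ x ∈ V, ∀ y ∈ W, ¬ A.Near m x y) (hsep' : ∀ x ∈ V', ∀ y ∈ W', ¬ B.Near m x y)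
    (h1 : ∀ x : Fin n → A.carrier, (∀ i, x i ∈ V) → (Q x ↔ Q' (f ∘ x)))
    (h2 : ∀ x : Fin n → A.carrier, (∀ i, x i ∈ W) → (Q x ↔ Q' (f ∘ x)))
    (x : Fin n → A.carrier) (hx : ∀ i, x i ∈ V ∪ W) : Q x ↔ Q' (f ∘ x) := by
  by_cases hall : ∀ i, x i ∈ V
  · exact h1 x hall
  by_cases hall' : ∀ i, x i ∈ W
  · exact h2 x hall'
  push Not at hall hall'
  obtain ⟨i, hi⟩ := hall
  obtain ⟨j, hj⟩ := hall'
  have hi' := (hx i).resolve_left hi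
  have hj' := (hx j).resolve_right hj
  exact ⟨fun h => absurd (hQ x h j i) (hsep _ hj' _ hi'),
    fun h => absurd (hQ' _ h j i) (hsep' _ (hV hj') _ (hW hi'))⟩

theorem local_rel {m : ℕ} (hm : 1 ≤ m) {n : ℕ} (R : L.Relations n) :
    Local (A := A) m (fun x : Fin n → A.carrier => RelMap R x) :=
  fun _ h i j => (near_one_of_rel h i j).mono hm

theorem BallIso.glue {m r : ℕ} (hm : 1 ≤ m) (hS : Local m S) (hT : Local m T)
    {X Y : Set A.carrier} {f e : A.carrier → B.carrier} (hf : BallIso S T r X f)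
    (he : BallIso S T r Y e) (hsep : ∀ x ∈ A.nb r X, ∀ y ∈ A.nb r Y, ¬ A.Near m x y)
    (hsep' : ∀ x ∈ B.nb r (f '' X), ∀ y ∈ B.nb r (e '' Y), ¬ B.Near m x y) :
    ∃ g, BallIso S T r (X ∪ Y) g ∧ Set.EqOn g f (A.nb r X) ∧ Set.EqOn g e (A.nb r Y) := by
  classical
  have hdisj : Disjoint (A.nb r X) (A.nb r Y) :=
    Set.disjoint_left.2 fun x hx hy => hsep x hx x hy (Near.refl _ _)
  let g : A.carrier → B.carrier := (A.nb r X).piecewise f e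
  have hgf : Set.EqOn g f (A.nb r X) := Set.piecewise_eqOn _ _ _
  have hge : Set.EqOn g e (A.nb r Y) :=
    (Set.piecewise_eqOn_compl _ _ _).mono hdisj.subset_compl_left
  have hf' := hf.congr hgf.symm
  have he' := he.congr hge.symm
  rw [← (hgf.mono (subset_nb _ _)).image_eq, ← (hge.mono (subset_nb _ _)).image_eq] at hsep'
  refine ⟨g, ⟨?_, fun n R x hx => ?_, fun x hx => ?_, fun c x hx => ?_⟩, hgf, hge⟩
  · rw [Set.image_union, nb_union, nb_union]
    refine hf'.bij.union he'.bij ?_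
    rw [Set.injOn_union hdisj]
    refine ⟨hf'.bij.injOn, he'.bij.injOn, fun x hx y hy hxy => ?_⟩
    refine hsep' _ (hf'.bij.mapsTo hx) _ (he'.bij.mapsTo hy) ?_
    rw [hxy]
    exact Near.refl _ _
  · rw [nb_union] at hx
    exact glue_iff (local_rel hm R) (local_rel hm R) hf'.bij.mapsTo he'.bij.mapsTo
      hsep hsep' (hf'.rel n R) (he'.rel n R) x hx
  · rw [nb_union] at hx
    exact glue_iff hS hT hf'.bij.mapsTo he'.bij.mapsTo hsep hsep' hf'.ext he'.ext x hx
  · rw [nb_union] at hx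
    exact hx.elim (hf'.const c x) (he'.const c x)

/-- Counting argument. If all realizations in `B` of the type of `a` were near the image of `X`,
they would be finitely many and would all be images of realizations near `X`, hence different from
`a`. So `B` would have fewer realizations than `A`. -/
theorem exists_ptIso_notMem_nb (hB : B ∈ locallyFinite L) (hcount : TypeCountEq S T) {r d R : ℕ}
    (hR : d + r ≤ R) {X : Set A.carrier} (hX : X.Finite) {f : A.carrier → B.carrier}
    (hf : BallIso S T R X f) {a : A.carrier} (ha : a ∉ A.nb d X) :
    ∃ b, PtIso S T r a b ∧ b ∉ B.nb d (f '' X) := by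
  by_contra! hcon
  have hsub : {b | PtIso S T r a b} ⊆ B.nb d (f '' X) := fun b hb => hcon b hb
  have hfin : {b | PtIso S T r a b}.Finite := (finite_nb hB d (hX.image f)).subset hsub
  have hcard := hcount r a
  have hfin' : {a' | PtIso S S r a a'}.Finite := by
    rw [← Set.encard_lt_top_iff, hcard]
    exact hfin.encard_lt_top
  have himg : {b | PtIso S T r a b} ⊆ f '' ({a' | PtIso S S r a a'} \ {a}) := by
    intro b hb
    have hb' := hsub hb
    rw [← hf.image_nb (d := 0) (by omega) (subset_nb _ _)] at hb'
    obtain ⟨x, hx, rfl⟩ := hb'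
    refine ⟨x, ⟨?_, ?_⟩, rfl⟩
    · exact PtIso.trans hb (hf.ptIso hR hx).symm
    · rintro rfl
      exact ha hx
  have h1 := (Set.encard_le_encard himg).trans (Set.encard_image_le _ _)
  rw [← hcard] at h1
  have h2 := (hfin'.subset Set.sdiff_subset).encard_lt_encard
    (Set.sdiff_singleton_ssubset.2 (show a ∈ {a' | PtIso S S r a a'} from PtIso.refl _ _))
  exact absurd h1 (not_le.2 h2)

/-- The forth step of Hanf's argument. The radius splits as `(2 * r + m) + r`: if `a` is within `2 *
r + m` of `X`, then `f` already covers its `r`-ball; otherwise a far realization of its type is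
chosen and the two maps are glued, since the `r`-balls are more than `m` apart. -/
theorem BallIso.exists_union_singleton {m r : ℕ} (hB : B ∈ locallyFinite L)
    (hm : 1 ≤ m) (hS : Local m S) (hT : Local m T) (hcount : TypeCountEq S T)
    {X : Set A.carrier} (hX : X.Finite) {f : A.carrier → B.carrier}
    (hf : BallIso S T (3 * r + m) X f) (a : A.carrier) :
    ∃ g, BallIso S T r (X ∪ {a}) g ∧ Set.EqOn g f X := by
  by_cases ha : a ∈ A.nb (2 * r + m) X
  · refine ⟨f, hf.restrict (d := 2 * r + m) (by omega) ?_, fun _ _ => rfl⟩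
    exact Set.union_subset (subset_nb _ _) (by simpa using ha)
  obtain ⟨b, ⟨e, he, rfl⟩, hb⟩ := exists_ptIso_notMem_nb hB hcount (r := r) (by omega) hX hf ha
  have key : ∀ {D : Str.{u, v, w} L} {X : Set D.carrier} {a : D.carrier},
      a ∉ D.nb (2 * r + m) X → ∀ x ∈ D.nb r X, ∀ y ∈ D.nb r {a}, ¬ D.Near m x y := by
    rintro D X a ha x hx y hy hxy
    rw [mem_nb_singleton] at hy
    exact ha (nb_of_near (r := r + m) (s := r) (by omega) (nb_of_near le_rfl hx hxy) hy.symm)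
  obtain ⟨g, hg, hgf, -⟩ := BallIso.glue hm hS hT (hf.mono (s := r) (by omega) subset_rfl) he
    (key ha) (by rw [Set.image_singleton]; exact key hb)
  exact ⟨g, hg, hgf.mono (subset_nb _ _)⟩

/-- The back step is the forth step for the inverse isomorphism, inverted again. -/
theorem BallIso.exists_back {m r : ℕ} (hA : A ∈ locallyFinite L)
    (hm : 1 ≤ m) (hS : Local m S) (hT : Local m T) (hcount : TypeCountEq T S)
    {X : Set A.carrier} (hX : X.Finite) {f : A.carrier → B.carrier}
    (hf : BallIso S T (3 * r + m) X f) (b : B.carrier) :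
    ∃ (a : A.carrier) (g : A.carrier → B.carrier),
      BallIso S T r (X ∪ {a}) g ∧ Set.EqOn g f X ∧ g a = b := by
  obtain ⟨e, he, hinv⟩ := hf.symm
  obtain ⟨e', he', hee⟩ := he.exists_union_singleton hA hm hT hS hcount (hX.image f) b
  obtain ⟨g, hg, hinv'⟩ := he'.symm
  have hsub := subset_nb r (f '' X ∪ {b})
  have hgb : g (e' b) = b := hinv'.1 (hsub (Or.inr rfl))
  have hback : ∀ x ∈ X, e' (f x) = x := fun x hx => by
    rw [hee ⟨x, hx, rfl⟩, hinv.1 (subset_nb _ _ hx)]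
  have himg : e' '' (f '' X ∪ {b}) = X ∪ {e' b} := by
    rw [Set.image_union, Set.image_singleton, Set.image_image, Set.image_congr hback,
      Set.image_id']
  rw [himg] at hg
  refine ⟨e' b, g, hg, fun x hx => ?_, hgb⟩
  have := hinv'.1 (hsub (Or.inl ⟨x, hx, rfl⟩))
  rwa [hback x hx] at this

end Str

/-! ### Hanf's theorem for sentences -/

section Hanf

open FirstOrder.Language

variable {L : FirstOrder.Language.{u, v}} {A B : Str.{u, v, w} L} {k : ℕ}
  {S : (Fin k → A.carrier) → Prop} {T : (Fin k → B.carrier) → Prop}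

/-- The values of the constant symbols. -/
def Str.consts (A : Str.{u, v, w} L) : Set A.carrier :=
  Set.range fun c : L.Constants => (c : A.carrier)

theorem Str.finite_consts [Finite L.Symbols] (A : Str.{u, v, w} L) : A.consts.Finite := by
  have : Finite (Σ l, L.Functions l) :=
    Finite.of_injective (β := L.Symbols) Sum.inl Sum.inl_injective
  have : Finite L.Constants := Finite.of_injective
    (β := Σ l, L.Functions l) (fun c => ⟨0, c⟩) fun c d h => by simpa using h
  exact Set.finite_range _

theorem realize_term_expand (hL : ∀ n : ℕ, IsEmpty (L.Functions (n + 1))) {n : ℕ}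
    (S : (Fin k → A.carrier) → Prop) (T : (Fin k → B.carrier) → Prop)
    {f : A.carrier → B.carrier} (hf : ∀ c : L.Constants, f c = c) (xs : Fin n → A.carrier)
    (t : (withRel L k).Term (Empty ⊕ Fin n)) :
    t.realize (M := (A.expand S).carrier) (Sum.elim default xs) ∈ Set.range xs ∪ A.consts ∧
      f (t.realize (M := (A.expand S).carrier) (Sum.elim default xs)) =
        t.realize (M := (B.expand T).carrier) (Sum.elim default (f ∘ xs)) := by
  induction t with
  | var v =>
    rcases v with v | i
    · exact v.elim
    · exact ⟨Or.inl ⟨i, rfl⟩, rfl⟩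
  | @func l F ts _ =>
    rcases F with F | F
    · cases l with
      | zero =>
        have hA : ∀ y : Fin 0 → A.carrier, Structure.funMap F y = (show L.Constants from F) :=
          fun y => congrArg _ (Subsingleton.elim _ _)
        have hB : ∀ y : Fin 0 → B.carrier, Structure.funMap F y = (show L.Constants from F) :=
          fun y => congrArg _ (Subsingleton.elim _ _)
        refine ⟨Or.inr ⟨F, (hA _).symm⟩, ?_⟩
        exact (congrArg f (hA _)).trans ((hf F).trans (hB _).symm)
      | succ l => exact (hL l).elim F
    · exact F.elim

/-- Back and forth by induction on the formula, with the radius growing from `r` to `3 * r + m` at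
each quantifier. The constants belong to the pebbled set from the start, so that terms never leave
it; finiteness of the signature keeps that set finite. -/
theorem realize_iff_of_ballIso [Finite L.Symbols] (hL : ∀ n : ℕ, IsEmpty (L.Functions (n + 1)))
    (hA : A ∈ locallyFinite L) (hB : B ∈ locallyFinite L) {m : ℕ} (hm : 1 ≤ m)
    (hS : Str.Local m S) (hT : Str.Local m T) (hcount : Str.TypeCountEq S T)
    (hcount' : Str.TypeCountEq T S) {n : ℕ} (φ : (withRel L k).BoundedFormula Empty n) :
    ∃ r : ℕ, ∀ (xs : Fin n → A.carrier) (f : A.carrier → B.carrier),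
      Str.BallIso S T r (Set.range xs ∪ A.consts) f → (∀ c : L.Constants, f c = c) →
      (φ.Realize (M := (A.expand S).carrier) default xs ↔
        φ.Realize (M := (B.expand T).carrier) default (f ∘ xs)) := by
  induction φ with
  | falsum => exact ⟨0, fun _ _ _ _ => Iff.rfl⟩
  | equal t₁ t₂ =>
    refine ⟨0, fun xs f hf hc => ?_⟩
    have h1 := realize_term_expand hL S T hc xs t₁
    have h2 := realize_term_expand hL S T hc xs t₂
    simp only [BoundedFormula.Realize]
    rw [← h1.2, ← h2.2]
    exact (hf.bij.injOn.eq_iff (Str.subset_nb _ _ h1.1) (Str.subset_nb _ _ h2.1)).symm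
  | rel R ts =>
    refine ⟨0, fun xs f hf hc => ?_⟩
    have h := fun i => realize_term_expand hL S T hc xs (ts i)
    simp only [BoundedFormula.Realize]
    simp only [← fun i => (h i).2]
    rcases R with R | R
    · exact hf.rel _ R _ fun i => Str.subset_nb _ _ (h i).1
    · cases R
      exact hf.ext _ fun i => Str.subset_nb _ _ (h i).1
  | imp φ ψ ih₁ ih₂ =>
    obtain ⟨r₁, h₁⟩ := ih₁
    obtain ⟨r₂, h₂⟩ := ih₂
    refine ⟨max r₁ r₂, fun xs f hf hc => ?_⟩
    simp only [BoundedFormula.realize_imp]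
    rw [h₁ xs f (hf.mono (le_max_left _ _) subset_rfl) hc,
      h₂ xs f (hf.mono (le_max_right _ _) subset_rfl) hc]
  | @all n φ ih =>
    obtain ⟨r, h⟩ := ih
    have hfin : ∀ xs : Fin n → A.carrier, (Set.range xs ∪ A.consts).Finite :=
      fun xs => (Set.finite_range xs).union A.finite_consts
    have hrange : ∀ (xs : Fin n → A.carrier) (a : A.carrier),
        Set.range (Fin.snoc (α := fun _ => A.carrier) xs a) ∪ A.consts =
          (Set.range xs ∪ A.consts) ∪ {a} := fun xs a => by
      rw [Fin.range_snoc, Set.insert_union, Set.union_singleton]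
    have hkey : ∀ (xs : Fin n → A.carrier) (f g : A.carrier → B.carrier) (a : A.carrier),
        (∀ c : L.Constants, f c = c) → Set.EqOn g f (Set.range xs ∪ A.consts) →
        Str.BallIso S T r (Set.range xs ∪ A.consts ∪ {a}) g →
        (φ.Realize (M := (A.expand S).carrier) default (Fin.snoc xs a) ↔
          φ.Realize (M := (B.expand T).carrier) default (Fin.snoc (f ∘ xs) (g a))) := by
      intro xs f g a hc hgf hg
      rw [← hrange] at hg
      have := h _ g hg fun c => (hgf (Or.inr ⟨c, rfl⟩)).trans (hc c)
      rw [this, Fin.comp_snoc]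
      have hxs : g ∘ xs = f ∘ xs := funext fun i => hgf (Or.inl ⟨i, rfl⟩)
      rw [hxs]
    refine ⟨3 * r + m, fun xs f hf hc => ?_⟩
    simp only [BoundedFormula.realize_all]
    constructor
    · intro hall b
      obtain ⟨a, g, hg, hgf, rfl⟩ := hf.exists_back hA hm hS hT hcount' (hfin xs) b
      exact (hkey xs f g a hc hgf hg).1 (hall a)
    · intro hall a
      obtain ⟨g, hg, hgf⟩ := hf.exists_union_singleton hB hm hS hT hcount (hfin xs) a
      exact (hkey xs f g a hc hgf hg).2 (hall _)

/-- A version of Hanf's theorem: sentences do not distinguish locally finite structures which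
realize the same neighborhoods the same number of times up to threshold `ω`. -/
theorem sat_iff_of_typeCountEq [Finite L.Symbols] (hL : ∀ n : ℕ, IsEmpty (L.Functions (n + 1)))
    (hA : A ∈ locallyFinite L) (hB : B ∈ locallyFinite L) {m : ℕ} (hm : 1 ≤ m)
    (hS : Str.Local m S) (hT : Str.Local m T) (hcount : Str.TypeCountEq S T)
    (hcount' : Str.TypeCountEq T S) {f : A.carrier → B.carrier}
    (hf : ∀ r, Str.BallIso S T r A.consts f) (hc : ∀ c : L.Constants, f c = c)
    (φ : (withRel L k).Sentence) : (A.expand S).Sat φ ↔ (B.expand T).Sat φ := by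
  obtain ⟨r, h⟩ := realize_iff_of_ballIso hL hA hB hm hS hT hcount hcount' φ
  have := h default f (by simpa using hf r) hc
  rw [Subsingleton.elim (f ∘ default) default] at this
  exact this

end Hanf

namespace Str

variable {L : FirstOrder.Language.{u, v}} {A B D : Str.{u, v, w} L} {k : ℕ}
  {S : (Fin k → A.carrier) → Prop} {T : (Fin k → B.carrier) → Prop} {U : (Fin k → D.carrier) → Prop}

/-! ### Closed embeddings -/

/-- The nullary relation which holds, as a trivial expansion of `A`. -/
def triv (A : Str.{u, v, w} L) : (Fin 0 → A.carrier) → Prop := fun _ => True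

theorem BallIso.changeExt {k' : ℕ} {S' : (Fin k' → A.carrier) → Prop}
    {T' : (Fin k' → B.carrier) → Prop} {r : ℕ} {X : Set A.carrier} {f : A.carrier → B.carrier}
    (h : BallIso S T r X f)
    (hext : ∀ x : Fin k' → A.carrier, (∀ i, x i ∈ A.nb r X) → (S' x ↔ T' (f ∘ x))) :
    BallIso S' T' r X f :=
  ⟨h.bij, h.rel, hext, h.const⟩

/-- An isomorphism of `A` with a union of connected components of `D` containing the constants. -/
structure ClosedEmb (g : A.carrier → D.carrier) : Prop where
  inj : Function.Injective g
  rel : ∀ (n : ℕ) (R : L.Relations n) (x : Fin n → A.carrier), RelMap R x ↔ RelMap R (g ∘ x)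
  const : ∀ c : L.Constants, g c = c
  closed : ∀ (a : A.carrier) (d : D.carrier), D.gaifman.Adj (g a) d → d ∈ Set.range g

namespace ClosedEmb

variable {g : A.carrier → D.carrier}

theorem near (hg : ClosedEmb g) {r : ℕ} {a b : A.carrier} (h : A.Near r a b) :
    D.Near r (g a) (g b) := by
  induction r generalizing b with
  | zero => rw [near_zero_iff] at h ⊢; rw [h]
  | succ r ih =>
    obtain ⟨z, hz, hzb⟩ := h.exists_step
    refine (ih hz).trans ?_
    rcases near_one_iff.1 hzb with ⟨-, n, R, c, hR, i, j, rfl, rfl⟩ | rfl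
    · exact near_one_of_rel ((hg.rel n R c).1 hR) i j
    · exact Near.refl _ _

/-- The range has no outgoing edges, so a path starting in it stays in it. Each tuple witnessing an
edge then lies wholly in the range and can be pulled back. -/
theorem exists_of_near (hg : ClosedEmb g) {r : ℕ} {a : A.carrier} {d : D.carrier}
    (h : D.Near r (g a) d) : ∃ b, g b = d ∧ A.Near r a b := by
  induction r generalizing d with
  | zero => exact ⟨a, near_zero_iff.1 h, Near.refl _ _⟩
  | succ r ih =>
    obtain ⟨z, hz, hzd⟩ := h.exists_step
    obtain ⟨b, rfl, hb⟩ := ih hz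
    rcases near_one_iff.1 hzd with ⟨-, n, R, c, hR, i, j, hi, rfl⟩ | rfl
    · have hc : ∀ l, c l ∈ Set.range g := fun l => by
        rcases near_one_iff.1 (near_one_of_rel hR i l) with h | h
        · exact hg.closed b _ (hi ▸ h)
        · exact ⟨b, by rw [← h, hi]⟩
      choose y hy using hc
      obtain rfl : g ∘ y = c := funext hy
      refine ⟨y j, rfl, hb.trans ?_⟩
      rw [← hg.inj hi]
      exact near_one_of_rel ((hg.rel n R y).2 hR) i j
    · exact ⟨b, rfl, hb.mono (Nat.le_succ r)⟩

theorem ballIso (hg : ClosedEmb g) (hSU : ∀ x, S x ↔ U (g ∘ x)) (r : ℕ) (X : Set A.carrier) :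
    BallIso S U r X g := by
  refine ⟨?_, fun n R x _ => hg.rel n R x, fun x _ => hSU x, fun c x _ => ?_⟩
  · have : g '' A.nb r X = D.nb r (g '' X) := by
      apply Set.Subset.antisymm
      · rintro _ ⟨y, ⟨x, hx, hxy⟩, rfl⟩
        exact ⟨g x, ⟨x, hx, rfl⟩, hg.near hxy⟩
      · rintro z ⟨_, ⟨x, hx, rfl⟩, hxz⟩
        obtain ⟨b, rfl, hb⟩ := hg.exists_of_near hxz
        exact ⟨b, ⟨x, hx, hb⟩, rfl⟩
    rw [← this]
    exact hg.inj.injOn.bijOn_image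
  · rw [← hg.const c, hg.inj.eq_iff]

theorem ptIso (hg : ClosedEmb g) (hSU : ∀ x, S x ↔ U (g ∘ x)) (r : ℕ) (a : A.carrier) :
    PtIso S U r a (g a) :=
  ⟨g, hg.ballIso hSU r {a}, rfl⟩

theorem ptIso_triv (hg : ClosedEmb g) (r : ℕ) (a : A.carrier) :
    PtIso A.triv D.triv r a (g a) :=
  hg.ptIso (S := A.triv) (U := D.triv) (fun _ => Iff.rfl) r a

theorem finite_neighborSet (hg : ClosedEmb g) (hA : A ∈ locallyFinite L) (a : A.carrier) :
    (D.gaifman.neighborSet (g a)).Finite := by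
  refine ((finite_nb hA 1 (Set.finite_singleton a)).image g).subset fun d hd => ?_
  obtain ⟨b, rfl, hb⟩ := hg.exists_of_near (near_one_iff.2 (Or.inl hd))
  exact ⟨b, mem_nb_singleton.2 hb, rfl⟩

/-- If the points outside the range of `g` have neighborhoods which occur infinitely often in
`(A, S)`, then `g` preserves the number of realizations of each neighborhood. -/
theorem typeCountEq (hg : ClosedEmb g) (hSU : ∀ x, S x ↔ U (g ∘ x))
    (hinf : ∀ d ∉ Set.range g, ∀ r, {a | PtIso U S r d a}.Infinite) :
    TypeCountEq S U ∧ TypeCountEq U S := by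
  have key : ∀ (r : ℕ) (a : A.carrier),
      {a' | PtIso S S r a a'}.encard = {d | PtIso S U r a d}.encard := by
    intro r a
    have hsub : g '' {a' | PtIso S S r a a'} ⊆ {d | PtIso S U r a d} := by
      rintro _ ⟨a', ha', rfl⟩
      exact PtIso.trans ha' (hg.ptIso hSU r a')
    -- A type realized only inside the range is counted by `g`; one also realized outside is
    -- infinite on both sides.
    by_cases h : ∀ d, PtIso S U r a d → d ∈ Set.range g
    · rw [← hg.inj.encard_image]
      congr 1
      refine hsub.antisymm fun d hd => ?_
      obtain ⟨a', rfl⟩ := h d hd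
      exact ⟨a', PtIso.trans hd (hg.ptIso hSU r a').symm, rfl⟩
    · push Not at h
      obtain ⟨d, hd, hdr⟩ := h
      have h1 : {a' | PtIso S S r a a'}.Infinite :=
        (hinf d hdr r).mono fun a' ha' => PtIso.trans hd ha'
      rw [h1.encard_eq, ((h1.image hg.inj.injOn).mono hsub).encard_eq]
  refine ⟨key, fun r d => ?_⟩
  by_cases hd : d ∈ Set.range g
  · obtain ⟨a, rfl⟩ := hd
    have ha := hg.ptIso hSU r a
    have h1 : {d | PtIso U U r (g a) d} = {d | PtIso S U r a d} :=
      Set.ext fun d => ⟨ha.trans, ha.symm.trans⟩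
    have h2 : {a' | PtIso U S r (g a) a'} = {a' | PtIso S S r a a'} :=
      Set.ext fun d => ⟨ha.trans, ha.symm.trans⟩
    rw [h1, h2, key]
  · have h1 := hinf d hd r
    have h2 : g '' {a | PtIso U S r d a} ⊆ {d' | PtIso U U r d d'} := by
      rintro _ ⟨a, ha, rfl⟩
      exact PtIso.trans ha (hg.ptIso hSU r a)
    rw [h1.encard_eq, ((h1.image hg.inj.injOn).mono h2).encard_eq]

end ClosedEmb

/-! ### Limits of expansions -/

/-- Pick pairs (index, point) with strictly increasing indices and new points. The `n`-th index is
at least `n`, so antitonicity puts the `n`-th point into `s n`. -/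
theorem exists_injective_seq {α : Type*} {s : ℕ → Set α} (hs : ∀ n, (s n).Infinite)
    (hanti : Antitone s) : ∃ a : ℕ → α, Function.Injective a ∧ ∀ n, a n ∈ s n := by
  classical
  obtain ⟨f, hf, hlt⟩ := exists_seq_of_forall_finset_exists
    (fun p : ℕ × α => p.2 ∈ s p.1) (fun p q => p.1 < q.1 ∧ p.2 ≠ q.2) (fun t _ => by
      obtain ⟨x, hx, hxt⟩ := (hs (t.sup Prod.fst + 1)).exists_notMem_finset (t.image Prod.snd)
      refine ⟨(t.sup Prod.fst + 1, x), hx, fun p hp => ⟨?_, ?_⟩⟩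
      · exact Nat.lt_succ_of_le (Finset.le_sup (f := Prod.fst) hp)
      · rintro rfl
        exact hxt (Finset.mem_image_of_mem _ hp))
  have hmono : StrictMono fun n => (f n).1 := strictMono_nat_of_lt_succ fun n =>
    (hlt n (n + 1) n.lt_succ_self).1
  refine ⟨fun n => (f n).2, fun i j hij => ?_, fun n => hanti (hmono.le_apply (x := n)) (hf n)⟩
  by_contra hne
  rcases lt_or_gt_of_ne hne with h | h
  · exact (hlt _ _ h).2 hij
  · exact (hlt _ _ h).2 hij.symm

/-- A representative of the connected component of `d`. -/
noncomputable def rep (D : Str.{u, v, w} L) (d : D.carrier) : D.carrier :=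
  (D.gaifman.connectedComponentMk d).out

theorem exists_near_rep (d : D.carrier) : ∃ n, D.Near n (D.rep d) d := by
  have h : D.gaifman.Reachable (D.rep d) d :=
    SimpleGraph.ConnectedComponent.exact (Quot.out_eq _)
  obtain ⟨p⟩ := h
  exact ⟨_, SimpleGraph.edist_le p⟩

theorem Near.rep_eq {n : ℕ} {d e : D.carrier} (h : D.Near n d e) : D.rep d = D.rep e := by
  have : D.gaifman.Reachable d e :=
    SimpleGraph.reachable_of_edist_ne_top (ne_top_of_le_ne_top (ENat.natCast_ne_top _) h)
  rw [Str.rep, SimpleGraph.ConnectedComponent.sound this, Str.rep]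

theorem ClosedEmb.rep_mem_range_iff {g : A.carrier → D.carrier} (hg : ClosedEmb g)
    {d : D.carrier} : D.rep d ∈ Set.range g ↔ d ∈ Set.range g := by
  obtain ⟨n, hn⟩ := exists_near_rep d
  constructor
  · rintro ⟨a, ha⟩
    rw [← ha] at hn
    obtain ⟨b, hb, -⟩ := hg.exists_of_near hn
    exact ⟨b, hb⟩
  · rintro ⟨a, rfl⟩
    obtain ⟨b, hb, -⟩ := hg.exists_of_near hn.symm
    exact ⟨b, hb⟩

/-- The component of `c` is the increasing union of its balls, each of which occurs infinitely often
in `A`. A limit along a nonprincipal ultrafilter of the pulled back relations therefore defines `U`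
on the whole component. Each finite ball sees only finitely many tuples, so `U` agrees there with a
single pullback for infinitely many indices. -/
theorem ClosedEmb.exists_extension {g : A.carrier → D.carrier} (hg : ClosedEmb g)
    (hA : A ∈ locallyFinite L) (hD : D ∈ locallyFinite L)
    (hinf : ∀ d ∉ Set.range g, ∀ r, {a | PtIso D.triv A.triv r d a}.Infinite)
    {m : ℕ} (hS : Local m S) :
    ∃ U : (Fin k → D.carrier) → Prop, Local m U ∧ (∀ x, S x ↔ U (g ∘ x)) ∧
      ∀ d ∉ Set.range g, ∀ r, {a | PtIso U S r d a}.Infinite := by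
  have hseq : ∀ c : D.carrier, ∃ f : ℕ → D.carrier → A.carrier, c ∉ Set.range g →
      (∀ i, BallIso D.triv A.triv i {c} (f i)) ∧ Function.Injective fun i => f i c := by
    intro c
    by_cases hc : c ∈ Set.range g
    · exact ⟨fun _ _ => Classical.arbitrary _, fun h => absurd hc h⟩
    obtain ⟨a, ha, hac⟩ := exists_injective_seq (hinf c hc) fun i j hij x hx => PtIso.mono hij hx
    choose f hf hfa using hac
    exact ⟨f, fun _ => ⟨hf, by simpa only [hfa] using ha⟩⟩
  choose f hf using hseq
  -- For `k = 0` the empty tuple belongs to no component; the nonemptiness condition leaves its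
  -- truth value to `S`.
  let U : (Fin k → D.carrier) → Prop := fun x =>
    (∃ y, g ∘ y = x ∧ S y) ∨ (Nonempty (Fin k) ∧ ∃ c ∉ Set.range g, (∀ i, D.rep (x i) = c) ∧
      ∀ᶠ i in (Filter.hyperfilter ℕ : Filter ℕ), S (f c i ∘ x))
  have hgt : ∀ n : ℕ, ∀ᶠ i in (Filter.hyperfilter ℕ : Filter ℕ), n ≤ i := fun n =>
    Nat.hyperfilter_le_atTop (Filter.eventually_ge_atTop n)
  have hSU : ∀ x, S x ↔ U (g ∘ x) := by
    refine fun x => ⟨fun h => Or.inl ⟨x, rfl, h⟩, ?_⟩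
    rintro (⟨y, hy, h⟩ | ⟨⟨i⟩, c, hc, hrep, -⟩)
    · rwa [← hg.inj.comp_left hy]
    · rw [← hrep i, hg.rep_mem_range_iff] at hc
      exact absurd ⟨x i, rfl⟩ hc
  refine ⟨U, ?_, hSU, fun d hd r => ?_⟩
  · rintro x (⟨y, rfl, h⟩ | ⟨-, c, hc, hrep, hx⟩) i j
    · exact hg.near (hS y h i j)
    · obtain ⟨p, hp⟩ := exists_near_rep (x i)
      obtain ⟨q, hq⟩ := exists_near_rep (x j)
      rw [hrep] at hp hq
      -- The ball of radius `l` must contain `x j` and the `m`-ball around `x i`: then the nearby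
      -- image of `x j` pulls back to a point near `x i`, which injectivity identifies with `x j`.
      obtain ⟨l, hl, hpl⟩ := (hx.and (hgt (max q (p + m)))).exists
      have hiso := (hf c hc).1 l
      have h1 : A.Near m (f c l (x i)) (f c l (x j)) := hS _ hl i j
      have h2 := hiso.image_nb (d := p) (s := m) (by omega)
        (Y := {x i}) (by simpa [mem_nb_singleton] using hp)
      rw [Set.image_singleton] at h2
      obtain ⟨y, hy, hyj⟩ := h2.ge (mem_nb_singleton.2 h1)
      rw [mem_nb_singleton] at hy
      have : y = x j := hiso.bij.injOn (mem_nb_singleton.2 ((hp.trans hy).mono (by omega)))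
        (mem_nb_singleton.2 (hq.mono (by omega))) hyj
      exact this ▸ hy
  · obtain ⟨q, hq⟩ := exists_near_rep d
    set c := D.rep d with hcd
    have hc : c ∉ Set.range g := by rwa [hcd, hg.rep_mem_range_iff]
    have hball : (D.nb r {d}).Finite := finite_nb hD r (Set.finite_singleton d)
    have htup : {x : Fin k → D.carrier | ∀ i, x i ∈ D.nb r {d}}.Finite :=
      Set.Finite.pi' fun _ => hball
    have hev : ∀ᶠ i in (Filter.hyperfilter ℕ : Filter ℕ),
        ∀ x ∈ {x : Fin k → D.carrier | ∀ i, x i ∈ D.nb r {d}}, (U x ↔ S (f c i ∘ x)) := by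
      rw [Filter.eventually_all_finite htup]
      intro x hx
      rcases isEmpty_or_nonempty (Fin k) with hk | hk
      · refine Filter.Eventually.of_forall fun i => ?_
        rw [Subsingleton.elim x (g ∘ (f c i ∘ x)), ← hSU,
          Subsingleton.elim (f c i ∘ (g ∘ (f c i ∘ x))) (f c i ∘ x)]
      · have hrep : ∀ i, D.rep (x i) = c := fun i => (mem_nb_singleton.1 (hx i)).rep_eq.symm
        have hUx : U x ↔ ∀ᶠ i in (Filter.hyperfilter ℕ : Filter ℕ), S (f c i ∘ x) := by
          constructor
          · rintro (⟨y, rfl, -⟩ | ⟨-, c', -, hrep', h⟩)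
            · refine absurd ⟨y hk.some, rfl⟩ (?_ : g (y hk.some) ∉ Set.range g)
              rw [← hg.rep_mem_range_iff]
              exact (hrep hk.some) ▸ hc
            · rwa [← hrep' hk.some, hrep] at h
          · exact fun h => Or.inr ⟨hk, c, hc, hrep, h⟩
        by_cases h : U x
        · filter_upwards [hUx.1 h] with i hi using ⟨fun _ => hi, fun _ => h⟩
        · have h' := Ultrafilter.eventually_not.2 (mt hUx.2 h)
          filter_upwards [h'] with i hi using ⟨fun h1 => absurd h1 h, fun h1 => absurd h1 hi⟩
    have hgood := (hev.and (hgt (q + r)))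
    have hVinf : {i | (∀ x ∈ {x : Fin k → D.carrier | ∀ i, x i ∈ D.nb r {d}},
        (U x ↔ S (f c i ∘ x))) ∧ q + r ≤ i}.Infinite :=
      fun hfin => Filter.notMem_hyperfilter_of_finite hfin hgood
    have hdq : d ∈ D.nb q {c} := mem_nb_singleton.2 hq
    -- Finitely many realizations would confine the centers `f c i c`, each within `q` of the
    -- realization `f c i d`, to a finite set. But these centers are distinct for infinitely many
    -- `i`.
    intro hfin
    refine hVinf (Set.Finite.of_finite_image ((finite_nb hA q hfin).subset ?_)
      ((hf c hc).2.injOn))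
    rintro _ ⟨i, ⟨hi, hqi⟩, rfl⟩
    have hiso := (hf c hc).1 i
    refine ⟨f c i d, ⟨f c i, ?_, rfl⟩, ?_⟩
    · exact (hiso.restrict hqi (by simpa using hdq)).changeExt hi
    · exact (hiso.near (d := 0) (by omega) (subset_nb _ _ rfl) hq).symm

end Str

/-! ### Elementary equivalence of a local expansion and its extension. -/

theorem Str.ClosedEmb.exists_expand_sat_iff {L : FirstOrder.Language.{u, v}} [Finite L.Symbols]
    (hL : ∀ n : ℕ, IsEmpty (L.Functions (n + 1))) {A D : Str.{u, v, w} L}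
    {g : A.carrier → D.carrier} (hg : Str.ClosedEmb g)
    (hA : A ∈ locallyFinite L) (hD : D ∈ locallyFinite L)
    (hinf : ∀ d ∉ Set.range g, ∀ r, {a | Str.PtIso D.triv A.triv r d a}.Infinite)
    {k m : ℕ} (hm : 1 ≤ m) {S : (Fin k → A.carrier) → Prop} (hS : Str.Local m S) :
    ∃ U : (Fin k → D.carrier) → Prop, ∀ φ : (withRel L k).Sentence,
      (A.expand S).Sat φ ↔ (D.expand U).Sat φ := by
  obtain ⟨U, hU, hSU, hinf'⟩ := hg.exists_extension hA hD hinf hS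
  obtain ⟨h1, h2⟩ := hg.typeCountEq hSU hinf'
  exact ⟨U, sat_iff_of_typeCountEq hL hA hD hm hS hU h1 h2
    (fun r => hg.ballIso hSU r _) hg.const⟩

namespace Str

variable {L : FirstOrder.Language.{u, v}} {A B D : Str.{u, v, w} L} {k : ℕ}
  {S : (Fin k → A.carrier) → Prop} {T : (Fin k → B.carrier) → Prop} {U : (Fin k → D.carrier) → Prop}

/-! ### Hanf equivalence -/

theorem mem_nbhd_const {a : A.carrier} {r : ℕ} {c : L.Constants} (x : A.closedBall a r) :
    (x : (A.nbhd a r).carrier) ∈ (A.nbhd a r).const c ↔ (x : A.carrier) = (c : A.carrier) := by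
  constructor
  · rintro ⟨h, hx⟩
    exact (congrArg Subtype.val hx).symm
  · exact fun h => ⟨(h ▸ x.2 : (c : A.carrier) ∈ A.closedBall a r), Subtype.ext h.symm⟩

theorem nbhd_iso_iff {r : ℕ} {a : A.carrier} {b : B.carrier} :
    (A.nbhd a r).Iso (B.nbhd b r) ↔ PtIso A.triv B.triv r a b := by
  classical
  constructor
  · rintro ⟨e, hpt, hrel, hconst⟩
    have hc : ∀ (c : L.Constants) (x : (A.nbhd a r).carrier),
        x ∈ (A.nbhd a r).const c ↔ e x ∈ (B.nbhd b r).const c := fun c x => by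
      rw [← hconst c, Part.mem_map_iff]
      constructor
      · exact fun h => ⟨_, h, rfl⟩
      · rintro ⟨y, hy, hyx⟩
        rwa [← e.injective hyx]
    change A.closedBall a r ≃ B.closedBall b r at e
    -- The value `b` outside the ball is arbitrary.
    let f : A.carrier → B.carrier := fun x => if h : x ∈ A.closedBall a r then e ⟨x, h⟩ else b
    have hf : ∀ x : A.closedBall a r, f x = e x := fun x => by simp [f]
    have hfa : f a = b := by
      rw [hf ⟨a, A.mem_closedBall_self a r⟩]
      exact congrArg Subtype.val hpt
    refine ⟨f, ⟨?_, fun n R x hx => ?_, fun _ _ => Iff.rfl, fun c x hx => ?_⟩, hfa⟩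
    · rw [Set.image_singleton, nb_singleton, nb_singleton, hfa]
      refine ⟨fun x hx => ?_, fun x hx y hy hxy => ?_, fun y hy => ?_⟩
      · rw [hf ⟨x, hx⟩]
        exact (e ⟨x, hx⟩).2
      · rw [hf ⟨x, hx⟩, hf ⟨y, hy⟩] at hxy
        exact congrArg Subtype.val (e.injective (Subtype.ext hxy))
      · obtain ⟨x, hx⟩ := e.surjective ⟨y, hy⟩
        refine ⟨x, x.2, ?_⟩
        rw [hf, hx]
    · rw [nb_singleton] at hx
      refine (hrel n R fun i => ⟨x i, hx i⟩).trans (iff_of_eq ?_)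
      exact congrArg _ (funext fun i => (hf ⟨x i, hx i⟩).symm)
    · rw [nb_singleton] at hx
      rw [hf ⟨x, hx⟩]
      exact (mem_nbhd_const ⟨x, hx⟩).symm.trans ((hc c ⟨x, hx⟩).trans (mem_nbhd_const _))
  · rintro ⟨f, hf, rfl⟩
    have hbij := hf.bij
    rw [Set.image_singleton, nb_singleton, nb_singleton] at hbij
    refine ⟨hbij.equiv f, rfl, fun n R x => ?_, fun c => ?_⟩
    · refine hf.rel n R (fun i => (show A.closedBall a r from x i).1) fun i => ?_
      rw [nb_singleton]
      exact (x i).2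
    · have key : ∀ x : A.closedBall a r, (x : (A.nbhd a r).carrier) ∈ (A.nbhd a r).const c ↔
          (hbij.equiv f x : (B.nbhd (f a) r).carrier) ∈ (B.nbhd (f a) r).const c := fun x => by
        rw [mem_nbhd_const, mem_nbhd_const]
        refine hf.const c x ?_
        rw [nb_singleton]
        exact x.2
      refine Part.ext fun y => ?_
      rw [Part.mem_map_iff]
      constructor
      · rintro ⟨x, hx, rfl⟩
        exact (key x).1 hx
      · intro hy
        obtain ⟨x, rfl⟩ := (hbij.equiv f).surjective y
        exact ⟨x, (key x).2 hy, rfl⟩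

theorem encard_eq_of_equipollentUpTo {α β : Type w} {X : Set α} {Y : Set β}
    (h : EquipollentUpTo ℵ₀ X Y) : X.encard = Y.encard := by
  rcases h with h | ⟨h1, h2⟩
  · exact congrArg Cardinal.toENat h
  · have hX : X.Infinite := Set.infinite_coe_iff.1 (Cardinal.infinite_iff.2 h1)
    have hY : Y.Infinite := Set.infinite_coe_iff.1 (Cardinal.infinite_iff.2 h2)
    rw [hX.encard_eq, hY.encard_eq]

theorem typeCountEq_of_hanfEquiv (h : HanfEquiv A B) :
    TypeCountEq A.triv B.triv ∧ TypeCountEq B.triv A.triv := by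
  have hsymm : ∀ {A B : Str.{u, v, w} L} (r : ℕ) (a : A.carrier),
      {b : B.carrier | (B.nbhd b r).Iso (A.nbhd a r)} = {b | PtIso A.triv B.triv r a b} :=
    fun r a => Set.ext fun b => nbhd_iso_iff.trans ⟨PtIso.symm, PtIso.symm⟩
  constructor
  · intro r a
    rw [← hsymm, ← hsymm]
    exact encard_eq_of_equipollentUpTo (h r _)
  · intro r b
    rw [← hsymm, ← hsymm]
    exact (encard_eq_of_equipollentUpTo (h r _)).symm

/-! ### Points whose neighborhoods occur finitely often -/

/-- Some neighborhood of `a` occurs only finitely often in `A`. -/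
def FinType (A : Str.{u, v, w} L) (a : A.carrier) : Prop :=
  ∃ r, {a' | PtIso A.triv A.triv r a a'}.Finite

theorem infinite_of_not_finType {a : A.carrier} (ha : ¬ A.FinType a) (r : ℕ) :
    {a' | PtIso A.triv A.triv r a a'}.Infinite :=
  fun h => ha ⟨r, h⟩

theorem TypeCountEq.finite_iff (h : TypeCountEq S T) {r : ℕ} {a : A.carrier} :
    {a' | PtIso S S r a a'}.Finite ↔ {b | PtIso S T r a b}.Finite := by
  rw [← Set.encard_lt_top_iff, h, Set.encard_lt_top_iff]

/-- Already the neighborhood of radius 0 determines the value of a constant. -/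
theorem finType_const (c : L.Constants) : A.FinType (c : A.carrier) := by
  refine ⟨0, (Set.finite_singleton (c : A.carrier)).subset ?_⟩
  rintro _ ⟨f, hf, rfl⟩
  exact (hf.const c c (subset_nb _ _ rfl)).1 rfl

/-- The `(1 + r)`-neighborhood of `b` shows a point within 1 with the `r`-type of `a`. So every
realization is within 1 of a finite set, which is finite by local finiteness. Consequently finite
type is constant on components. -/
theorem FinType.of_near_one (hA : A ∈ locallyFinite L) {a b : A.carrier} (ha : A.FinType a)
    (h : A.Near 1 a b) : A.FinType b := by
  obtain ⟨r, hr⟩ := ha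
  refine ⟨1 + r, (finite_nb hA 1 hr).subset ?_⟩
  rintro _ ⟨f, hf, rfl⟩
  refine ⟨f a, ?_, (hf.near (d := 0) (by omega) (subset_nb _ _ rfl) h.symm).symm⟩
  exact hf.ptIso (d := 1) le_rfl (mem_nb_singleton.2 h.symm)

theorem exists_ballIso (hB : B ∈ locallyFinite L) (hcount : TypeCountEq A.triv B.triv)
    {X : Set A.carrier} (hX : X.Finite) (r : ℕ) : ∃ f, BallIso A.triv B.triv r X f := by
  induction X, hX using Set.Finite.induction_on generalizing r with
  | empty =>
    have a := Classical.arbitrary A.carrier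
    have h : {b | PtIso A.triv B.triv r a b}.Nonempty := by
      rw [← Set.encard_ne_zero, ← hcount, Set.encard_ne_zero]
      exact ⟨a, PtIso.refl _ _⟩
    obtain ⟨_, f, hf, -⟩ := h
    exact ⟨f, hf.mono le_rfl (Set.empty_subset _)⟩
  | @insert a X _ hX ih =>
    -- The trivial nullary expansion is vacuously local for every bound, so `m = 1` serves.
    obtain ⟨f, hf⟩ := ih (3 * r + 1)
    obtain ⟨g, hg, -⟩ := hf.exists_union_singleton hB le_rfl (fun _ _ i => i.elim0)
      (fun _ _ i => i.elim0) hcount hX a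
    exact ⟨g, hg.mono le_rfl (by rw [Set.union_singleton])⟩

/-- A compactness argument valid in any cardinality: `h` is the limit of isomorphisms of
neighborhoods of finite sets, indexed by the set and the radius. On any finite set of points of
finite type, `h` agrees with such an isomorphism of any prescribed radius, which gives injectivity
and preservation of relations and constants. -/
theorem exists_finType_bijOn (hB : B ∈ locallyFinite L)
    (hcount : TypeCountEq A.triv B.triv) (hcount' : TypeCountEq B.triv A.triv) :
    ∃ h : A.carrier → B.carrier, Set.BijOn h {a | A.FinType a} {b | B.FinType b} ∧
      (∀ (n : ℕ) (R : L.Relations n) (x : Fin n → A.carrier), (∀ i, A.FinType (x i)) →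
        (RelMap R x ↔ RelMap R (h ∘ x))) ∧
      ∀ c : L.Constants, h c = c := by
  classical
  choose f hf using fun p : Finset A.carrier × ℕ =>
    exists_ballIso hB hcount p.1.finite_toSet p.2
  let F : Ultrafilter (Finset A.carrier × ℕ) := Ultrafilter.of Filter.atTop
  have hF : ∀ p₀, ∀ᶠ p in (F : Filter (Finset A.carrier × ℕ)), p₀ ≤ p := fun p₀ =>
    Ultrafilter.of_le Filter.atTop (Filter.eventually_ge_atTop p₀)
  have hlim : ∀ a, ∃ b, A.FinType a → ∀ᶠ p in (F : Filter (Finset A.carrier × ℕ)), f p a = b := by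
    intro a
    by_cases ha : A.FinType a
    · obtain ⟨r, hr⟩ := ha
      have hfin := hcount.finite_iff.1 hr
      -- Eventually `f p a` lies in a finite set of candidates, so the ultrafilter selects one.
      have hev : ∀ᶠ p in (F : Filter (Finset A.carrier × ℕ)),
          ∃ b ∈ {b | PtIso A.triv B.triv r a b}, f p a = b := by
        filter_upwards [hF ({a}, r)] with p hp
        refine ⟨_, ?_, rfl⟩
        exact (hf p).ptIso (d := 0) (by simpa using hp.2) (subset_nb _ _ (by simpa using hp.1))
      obtain ⟨b, -, hb⟩ := (Ultrafilter.eventually_exists_mem_iff hfin).1 hev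
      exact ⟨b, fun _ => hb⟩
    · exact ⟨Classical.arbitrary _, fun h => absurd h ha⟩
  choose h hh using hlim
  have key : ∀ (X : Set A.carrier), X.Finite → (∀ a ∈ X, A.FinType a) → ∀ r, ∃ f,
      BallIso A.triv B.triv r X f ∧ Set.EqOn f h X := by
    intro X hX hfin r
    have hev : ∀ᶠ p in (F : Filter (Finset A.carrier × ℕ)), ∀ a ∈ X, f p a = h a :=
      (Filter.eventually_all_finite hX).2 fun a ha => hh a (hfin a ha)
    obtain ⟨p, hp, hpX⟩ := (hev.and (hF (hX.toFinset, r))).exists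
    refine ⟨f p, (hf p).mono hpX.2 fun a ha => ?_, hp⟩
    exact hpX.1 (hX.mem_toFinset.2 ha)
  have hpt : ∀ a, A.FinType a → ∀ r, PtIso A.triv B.triv r a (h a) := by
    intro a ha r
    obtain ⟨f, hf, hfh⟩ := key {a} (Set.finite_singleton a) (by simpa using ha) r
    exact ⟨f, hf, hfh rfl⟩
  have hinj : Set.InjOn h {a | A.FinType a} := by
    intro a ha b hb hab
    obtain ⟨f, hf, hfh⟩ := key {a, b} (Set.toFinite _) (by
      rintro x (rfl | rfl)
      exacts [ha, hb]) 0
    refine hf.bij.injOn (subset_nb _ _ (Or.inl rfl)) (subset_nb _ _ (Or.inr rfl)) ?_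
    rw [hfh (Or.inl rfl), hfh (Or.inr rfl), hab]
  refine ⟨h, ⟨fun a ha => ?_, hinj, fun b hb => ?_⟩, fun n R x hx => ?_, fun c => ?_⟩
  · obtain ⟨r, hr⟩ := ha
    refine ⟨r, (hcount.finite_iff.1 hr).subset fun b hb => ?_⟩
    exact (hpt a ⟨r, hr⟩ r).trans hb
  · obtain ⟨r, hr⟩ := hb
    have hfin := hcount'.finite_iff.1 hr
    have hsub : {a | PtIso B.triv A.triv r b a} ⊆ {a | A.FinType a} := fun a ha =>
      ⟨r, hfin.subset fun a' ha' => PtIso.trans ha ha'⟩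
    have himg : h '' {a | PtIso B.triv A.triv r b a} ⊆ {b' | PtIso B.triv B.triv r b b'} := by
      rintro _ ⟨a, ha, rfl⟩
      exact PtIso.trans ha (hpt a (hsub ha) r)
    -- Surjectivity by counting: `h` injects the realizations in `A` into an equally large finite
    -- set of realizations in `B`.
    have heq := hr.eq_of_subset_of_encard_le' himg (by
      rw [(hinj.mono hsub).encard_image, hcount'])
    obtain ⟨a, ha, hab⟩ := heq.ge (PtIso.refl r b)
    exact ⟨a, hsub ha, hab⟩
  · obtain ⟨f, hf, hfh⟩ := key (Set.range x) (Set.finite_range x)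
      (by rintro _ ⟨i, rfl⟩; exact hx i) 0
    rw [hf.rel n R x fun i => subset_nb _ _ ⟨i, rfl⟩]
    exact iff_of_eq (congrArg _ (funext fun i => hfh ⟨i, rfl⟩))
  · obtain ⟨f, hf, hfh⟩ := key {(c : A.carrier)} (Set.finite_singleton _)
      (by simpa using finType_const c) 0
    rw [← hfh rfl]
    exact (hf.const c c (subset_nb _ _ rfl)).1 rfl

/-! ### Adjoining the points of infinite type -/

/-- The disjoint union of `A` and of the restriction of `B` to `X`. The constants and the nullary
relations are those of `A`. -/
def adjoin (hL : ∀ n : ℕ, IsEmpty (L.Functions (n + 1))) (A B : Str.{u, v, w} L)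
    (X : Set B.carrier) : Str.{u, v, w} L where
  carrier := A.carrier ⊕ X
  str :=
    { funMap := fun {n} => match n with
        | 0 => fun F _ => Sum.inl (show L.Constants from F : A.carrier)
        | n + 1 => fun F _ => (hL n).elim F
      RelMap := fun {n} R x => (∃ y, Sum.inl ∘ y = x ∧ RelMap R y) ∨
        (Nonempty (Fin n) ∧ ∃ y : Fin n → X, Sum.inr ∘ y = x ∧ RelMap R fun i => (y i : B.carrier)) }
  nonempty := inferInstance

namespace adjoin

variable {hL : ∀ n : ℕ, IsEmpty (L.Functions (n + 1))} {X : Set B.carrier}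

/-- The inclusion of the first summand. -/
def inl : A.carrier → (adjoin hL A B X).carrier := Sum.inl

/-- The inclusion of the second summand. -/
def inr : X → (adjoin hL A B X).carrier := Sum.inr

theorem inl_injective : Function.Injective (inl : A.carrier → (adjoin hL A B X).carrier) :=
  Sum.inl_injective

theorem inr_injective : Function.Injective (inr : X → (adjoin hL A B X).carrier) :=
  Sum.inr_injective

theorem inl_ne_inr {a : A.carrier} {b : X} : (inl a : (adjoin hL A B X).carrier) ≠ inr b :=
  Sum.inl_ne_inr

theorem eq_inl_or_inr (d : (adjoin hL A B X).carrier) :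
    (∃ a, d = inl a) ∨ ∃ b, d = inr b := by
  rcases d with a | b
  exacts [Or.inl ⟨a, rfl⟩, Or.inr ⟨b, rfl⟩]

theorem relMap_iff {n : ℕ} {R : L.Relations n} {x : Fin n → (adjoin hL A B X).carrier} :
    RelMap R x ↔ (∃ y, inl ∘ y = x ∧ RelMap R y) ∨
      (Nonempty (Fin n) ∧ ∃ y : Fin n → X, inr ∘ y = x ∧ RelMap R fun i => (y i : B.carrier)) :=
  Iff.rfl

theorem relMap_inl {n : ℕ} {R : L.Relations n} {x : Fin n → A.carrier} :
    RelMap R ((inl : A.carrier → (adjoin hL A B X).carrier) ∘ x) ↔ RelMap R x := by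
  rw [relMap_iff]
  constructor
  · rintro (⟨y, hy, h⟩ | ⟨⟨i⟩, y, hy, -⟩)
    · rwa [← inl_injective.comp_left hy]
    · exact absurd (congrFun hy i).symm inl_ne_inr
  · exact fun h => Or.inl ⟨x, rfl, h⟩

theorem relMap_inr {n : ℕ} (hn : Nonempty (Fin n)) {R : L.Relations n} {x : Fin n → X} :
    RelMap R ((inr : X → (adjoin hL A B X).carrier) ∘ x) ↔
      RelMap R fun i => (x i : B.carrier) := by
  rw [relMap_iff]
  constructor
  · rintro (⟨y, hy, -⟩ | ⟨-, y, hy, h⟩)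
    · exact absurd (congrFun hy hn.some) inl_ne_inr
    · rwa [← inr_injective.comp_left hy]
  · exact fun h => Or.inr ⟨hn, x, rfl, h⟩

theorem closedEmb_inl (hL : ∀ n : ℕ, IsEmpty (L.Functions (n + 1))) (A B : Str.{u, v, w} L)
    (X : Set B.carrier) : ClosedEmb (inl : A.carrier → (adjoin hL A B X).carrier) where
  inj := inl_injective
  rel _ _ _ := relMap_inl.symm
  const _ := rfl
  closed := by
    rintro a d ⟨-, n, R, c, hR, i, j, hi, rfl⟩
    rcases relMap_iff.1 hR with ⟨y, rfl, -⟩ | ⟨-, y, rfl, -⟩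
    · exact ⟨y j, rfl⟩
    · exact absurd hi.symm inl_ne_inr

end adjoin

theorem FinType.of_rel (hA : A ∈ locallyFinite L) {n : ℕ} {R : L.Relations n}
    {x : Fin n → A.carrier} (h : RelMap R x) {i : Fin n} (hi : A.FinType (x i)) (j : Fin n) :
    A.FinType (x j) :=
  hi.of_near_one hA (near_one_of_rel h i j)

/-- The embedding is `h` on points of finite type and the inclusion elsewhere. It respects relations
because no related tuple mixes the two kinds of points. -/
theorem exists_closedEmb_adjoin (hL : ∀ n : ℕ, IsEmpty (L.Functions (n + 1)))
    (hA : A ∈ locallyFinite L) (hB : B ∈ locallyFinite L)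
    {h : B.carrier → A.carrier} (hbij : Set.BijOn h {b | B.FinType b} {a | A.FinType a})
    (hrel : ∀ (n : ℕ) (R : L.Relations n) (x : Fin n → B.carrier), (∀ i, B.FinType (x i)) →
        (RelMap R x ↔ RelMap R (h ∘ x)))
    (hconst : ∀ c : L.Constants, h c = c) :
    ∃ g : B.carrier → (adjoin hL A B {b | ¬ B.FinType b}).carrier,
      ClosedEmb g ∧
      (∀ b : {b | ¬ B.FinType b}, g b = adjoin.inr b) ∧ ∀ a, A.FinType a → ∃ b, g b = adjoin.inl a := by
  classical
  let g : B.carrier → (adjoin hL A B {b | ¬ B.FinType b}).carrier := fun b =>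
    if hb : B.FinType b then adjoin.inl (h b) else adjoin.inr ⟨b, hb⟩
  have hfin : ∀ {b}, B.FinType b → g b = adjoin.inl (h b) := fun hb => dif_pos hb
  have hinf : ∀ b : {b : B.carrier | ¬ B.FinType b}, g b = adjoin.inr b := fun b => dif_neg b.2
  have hinl : ∀ a, A.FinType a → ∃ b, g b = adjoin.inl a := fun a ha => by
    obtain ⟨b, hb, rfl⟩ := hbij.surjOn ha
    exact ⟨b, hfin hb⟩
  have hcases : ∀ {b a}, g b = adjoin.inl a → B.FinType b ∧ h b = a := fun {b a} hb => by
    by_cases hb' : B.FinType b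
    · exact ⟨hb', adjoin.inl_injective ((hfin hb').symm.trans hb)⟩
    · exact absurd (hb.symm.trans (hinf ⟨b, hb'⟩)) adjoin.inl_ne_inr
  have hcases' : ∀ {b : B.carrier} {b'}, g b = adjoin.inr b' → b = b' := fun {b b'} hb => by
    by_cases hb' : B.FinType b
    · exact absurd ((hfin hb').symm.trans hb) adjoin.inl_ne_inr
    · exact congrArg Subtype.val (adjoin.inr_injective ((hinf ⟨b, hb'⟩).symm.trans hb))
  refine ⟨g, ⟨fun b b' hbb' => ?_, fun n R x => ?_, fun c => ?_, ?_⟩, hinf, hinl⟩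
  · rcases hb : g b' with a | b''
    · obtain ⟨h1, h2⟩ := hcases hb
      obtain ⟨h3, h4⟩ := hcases (hbb'.trans hb)
      exact hbij.injOn h3 h1 (h4.trans h2.symm)
    · rw [hcases' hb, hcases' (hbb'.trans hb)]
  -- Empty tuples fall under this case, so nullary relations are transferred by `hrel`.
  · by_cases hx : ∀ i, B.FinType (x i)
    · have : g ∘ x = adjoin.inl ∘ (h ∘ x) := funext fun i => hfin (hx i)
      rw [this, adjoin.relMap_inl]
      exact hrel n R x hx
    by_cases hx' : ∀ i, ¬ B.FinType (x i)
    · have : g ∘ x = adjoin.inr ∘ fun i => (⟨x i, hx' i⟩ : {b : B.carrier | ¬ B.FinType b}) :=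
        funext fun i => hinf ⟨x i, hx' i⟩
      push Not at hx
      rw [this, adjoin.relMap_inr hx.nonempty]
    push Not at hx hx'
    obtain ⟨i, hi⟩ := hx
    obtain ⟨j, hj⟩ := hx'
    refine ⟨fun hR => absurd (hj.of_rel hB hR i) hi, fun hR => ?_⟩
    rcases adjoin.relMap_iff.1 hR with ⟨y, hy, -⟩ | ⟨-, y, hy, -⟩
    · exact absurd (hcases (congrFun hy i).symm).1 hi
    · exact absurd ((hfin hj).symm.trans (congrFun hy j).symm) adjoin.inl_ne_inr
  · rw [hfin (finType_const c), hconst]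
    rfl
  · rintro b d ⟨-, n, R, c, hR, i, j, hi, rfl⟩
    rcases adjoin.relMap_iff.1 hR with ⟨y, rfl, hR'⟩ | ⟨-, y, rfl, -⟩
    · obtain ⟨h1, h2⟩ := hcases hi.symm
      have h3 : A.FinType (y i) := h2 ▸ hbij.mapsTo h1
      exact hinl _ (h3.of_rel hA hR' j)
    · exact ⟨y j, hinf (y j)⟩

/-- Hanf equivalent locally finite structures embed into a common locally finite structure such
that the neighborhoods of the remaining points occur infinitely often in both. -/
theorem exists_common_closedEmb (hL : ∀ n : ℕ, IsEmpty (L.Functions (n + 1)))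
    (hA : A ∈ locallyFinite L) (hB : B ∈ locallyFinite L) (hAB : HanfEquiv A B) :
    ∃ D ∈ locallyFinite L, ∃ (f : A.carrier → Str.carrier D) (g : B.carrier → D.carrier),
      ClosedEmb f ∧ (∀ d ∉ Set.range f, ∀ r, {a | PtIso D.triv A.triv r d a}.Infinite) ∧
      ClosedEmb g ∧ (∀ d ∉ Set.range g, ∀ r, {b | PtIso D.triv B.triv r d b}.Infinite) := by
  obtain ⟨h1, h2⟩ := typeCountEq_of_hanfEquiv hAB
  obtain ⟨h, hbij, hrel, hconst⟩ := exists_finType_bijOn hA h2 h1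
  obtain ⟨g, hg, hginr, hginl⟩ := exists_closedEmb_adjoin hL hA hB hbij hrel hconst
  have hf := adjoin.closedEmb_inl hL A B {b | ¬ B.FinType b}
  refine ⟨adjoin hL A B {b | ¬ B.FinType b}, ?_, adjoin.inl, g, hf, ?_, hg, ?_⟩
  · intro d
    rcases adjoin.eq_inl_or_inr d with ⟨a, rfl⟩ | ⟨b, rfl⟩
    · exact hf.finite_neighborSet hA a
    · rw [← hginr b]
      exact hg.finite_neighborSet hB b
  · intro d hd r
    rcases adjoin.eq_inl_or_inr d with ⟨a, rfl⟩ | ⟨b, rfl⟩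
    · exact absurd ⟨a, rfl⟩ hd
    · have hiso := hg.ptIso_triv r b
      have := (not_congr h2.finite_iff).1 (infinite_of_not_finType b.2 r)
      rw [← hginr b]
      exact Set.Infinite.mono (fun a ha => hiso.symm.trans ha) this
  · intro d hd r
    rcases adjoin.eq_inl_or_inr d with ⟨a, rfl⟩ | ⟨b, rfl⟩
    · have ha : ¬ A.FinType a := fun hfin => hd (hginl a hfin)
      have hiso := hf.ptIso_triv r a
      have := (not_congr h1.finite_iff).1 (infinite_of_not_finType ha r)
      exact Set.Infinite.mono (fun b hb => hiso.symm.trans hb) this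
    · exact absurd ⟨_, hginr b⟩ hd

/-! ### Neighborhood boundedness and the conclusion. -/

theorem local_of_closedBall_subset {m : ℕ}
    (h : ∀ a : A.carrier, (A.expand S).closedBall a 1 ⊆ A.closedBall a m) : Local m S := by
  intro x hx i j
  refine h (x i) (near_one_of_rel (A := A.expand S)
    (R := (Sum.inr SingleRel.sym : (withRel L k).Relations k)) (x := x) hx i j)

end Str

theorem mainTheorem1 (L : FirstOrder.Language.{u, v}) [Finite L.Symbols]
    (hL : ∀ n : ℕ, IsEmpty (L.Functions (n + 1))) (k : ℕ)
    (P : Set (Str.{u, v, w} (withRel L k)))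
    (hP : IsElementaryScheme P (locallyFinite L)) (hPb : NeighborhoodBounded P)
    (J : Set (Str.{u, v, w} L)) (hJ : IsInvariantElementary P (locallyFinite L) J)
    (A B : Str.{u, v, w} L) (hA : A ∈ locallyFinite L) (hB : B ∈ locallyFinite L)
    (hAB : HanfEquiv A B) :
    A ∈ J ↔ B ∈ J := by
  obtain ⟨⟨-, hex⟩, θ, hθ⟩ := hP
  obtain ⟨ν, hν⟩ := hPb
  obtain ⟨φ, hinv, hφ⟩ := hJ
  obtain ⟨D, hD, f, g, hf, hfinf, hg, hginf⟩ := Str.exists_common_closedEmb hL hA hB hAB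
  have key : ∀ {C : Str.{u, v, w} L} (hC : C ∈ locallyFinite L) {g : C.carrier → D.carrier}
      (_ : Str.ClosedEmb g)
      (_ : ∀ d ∉ Set.range g, ∀ r, {a | Str.PtIso D.triv C.triv r d a}.Infinite),
      C ∈ J ↔ D ∈ J := by
    intro C hC g hg hinf
    have hext : ∀ S, C.expand S ∈ P →
        ∃ U, D.expand U ∈ P ∧ ((C.expand S).Sat φ ↔ (D.expand U).Sat φ) := by
      intro S hS
      -- The bound must be at least 1 to cover the relations of `L` as well; `ν` itself may be 0.
      have hloc : Str.Local (ν + 1) S := fun x hx i j =>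
        (Str.local_of_closedBall_subset (hν C hC S hS) x hx i j).mono (Nat.le_succ ν)
      obtain ⟨U, hU⟩ := hg.exists_expand_sat_iff hL hC hD hinf (Nat.le_add_left 1 ν) hloc
      -- Elementarity of the scheme enters here: `U` inherits `θ` from `S`, so it is a presentation
      -- of `D`.
      exact ⟨U, (hθ D hD U).2 ((hU θ).1 ((hθ C hC S).1 hS)), hU φ⟩
    rw [hφ C hC, hφ D hD]
    constructor
    · rintro ⟨S, hS, hSφ⟩
      obtain ⟨U, hU, hiff⟩ := hext S hS
      exact ⟨U, hU, hiff.1 hSφ⟩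
    · intro h
      obtain ⟨S, hS⟩ := hex C hC
      obtain ⟨U, hU, hiff⟩ := hext S hS
      -- A presentation of `D` satisfying `φ` need not come from `C`; invariance over `D` transfers
      -- `φ` to the extension `U` of `S`.
      exact ⟨S, hS, hiff.2 ((hinv D hD).1 h U hU)⟩
  exact (key hA hf hfinf).trans (key hB hg hginf).symm
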